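/- Let $k$ be an algebraically closed field. A linear category is an additive $k$-linear category; linear functors are additive and $k$-linear on morphisms; a bilinear functor is linear in each variable. For an endofunctor $g$ of a category $\mathcal C$ put $\mathrm{ttr}(g)=\mathrm{Nat}(\mathrm{id}_{\mathcal C},g)$, the $k$-vector space of natural transformations $\mathrm{id}_{\mathcal C}\Rightarrow g$ when $\mathcal C$ is $k$-linear. For linear categories $\mathcal V,\mathcal W$, the (uncompleted) tensor product is a linear category $\mathcal V\boxtimes\mathcal W$ with a bilinear functor $\boxtimes:\mathcal V\times\mathcal W\to\mathcal V\boxtimes\mathcal W$ such that, for every linear category $\mathcal Z$, precomposition with $\boxtimes$ is an equivalence from linear functors $\mathcal V\boxtimes\mathcal W\to\mathcal Z$ to bilinear functors $\mathcal V\times\mathcal W\to\mathcal Z$. For linear endofunctors $g$ of $\mathcal V$ and $h$ of $\mathcal W$, $g\boxtimes h$ is the linear endofunctor of $\mathcal V\boxtimes\mathcal W$ determined, up to unique compatible isomorphism, by a natural isomorphism $\iota:\boxtimes\circ(g\times h)\cong(g\boxtimes h)\circ\boxtimes$. It is functorial in $(g,h)$, and there is a canonical isomorphism $\kappa_1:\mathrm{id}_{\mathcal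 V}\boxtimes\mathrm{id}_{\mathcal W}\cong\mathrm{id}_{\mathcal V\boxtimes\mathcal W}$ compatible with $\iota$. Let $$\mu:\mathrm{ttr}(g)\otimes_k\mathrm{ttr}(h)\to\mathrm{ttr}(g\boxtimes h)$$ be the linear map with $\mu(\phi\otimes\psi)=(\phi\boxtimes\psi)\circ\kappa_1^{-1}$. For $k$-linear abelian categories $\mathcal A,\mathcal B$, the Deligne tensor product is a $k$-linear abelian category $\mathcal A\,\widehat\boxtimes\,\mathcal B$ with a bilinear functor $\widehat\boxtimes:\mathcal A\times\mathcal B\to\mathcal A\,\widehat\boxtimes\,\mathcal B$, right exact in each variable, such that for every $k$-linear abelian category $\mathcal Z$ precomposition with $\widehat\boxtimes$ is an equivalence from right exact linear functors $\mathcal A\,\widehat\boxtimes\,\mathcal B\to\mathcal Z$ to bilinear functors $\mathcal A\times\mathcal B\to\mathcal Z$ that are right exact in each variable. For right exact linear endofunctors $g$ of $\mathcal A$ and $h$ of $\mathcal B$, the right exact linear endofunctor $g\,\widehat\boxtimes\,h$ is defined as above, from $\widehat\boxtimes\circ(g\times h)$. Theorem. (1) Let $\mathcal V$ and $\mathcal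 W$ be linear categories all of whose $\mathrm{Hom}$-spaces are finite-dimensional over $k$, let $g$ be a linear endofunctor of $\mathcal V$ and $h$ a linear endofunctor of $\mathcal W$. If $\mathrm{ttr}(g)$ or $\mathrm{ttr}(h)$ is finite-dimensional, then $\mu:\mathrm{ttr}(g)\otimes_k\mathrm{ttr}(h)\to\mathrm{ttr}(g\boxtimes h)$ is an isomorphism. (2) Let $\mathcal A$ and $\mathcal B$ be $k$-linear abelian categories satisfying Deligne's finiteness condition (all objects have finite length and all $\mathrm{Hom}$-spaces are finite-dimensional over $k$). For right exact linear endofunctors $g$ of $\mathcal A$ and $h$ of $\mathcal B$ such that $\mathrm{ttr}(g)$ or $\mathrm{ttr}(h)$ is finite-dimensional, there is an isomorphism of $k$-vector spaces $$\mathrm{ttr}(g\boxtimes h)\to\mathrm{ttr}(g\,\widehat\boxtimes\,h)$$ which is natural in $g$ and $h$. -/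

import Mathlib

open CategoryTheory CategoryTheory.Limits
open scoped TensorProduct

universe w v v' u u' u₁ u₂ u₃

noncomputable section

namespace CatTrace

/-! ### Linear and bilinear functors -/

section Functors

variable (k : Type u') [Field k]

/-- Linear functors: additive functors that are `k`-linear on morphisms. -/
def isLin (C : Type u₁) [Category.{v} C] [Preadditive C] [Linear k C]
    (D : Type u₂) [Category.{v'} D] [Preadditive D] [Linear k D] : ObjectProperty (C ⥤ D) :=
  fun F => F.Additive ∧ F.Linear k

/-- The category of `k`-linear functors and natural transformations. -/
abbrev LinFun (C : Type u₁) [Category.{v} C] [Preadditive C] [Linear k C]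
    (D : Type u₂) [Category.{v'} D] [Preadditive D] [Linear k D] :=
  (isLin k C D).FullSubcategory

/-- Functors on a product of categories that are `k`-linear in each variable. -/
def isBil (V : Type u₁) [Category.{v} V] [Preadditive V] [Linear k V]
    (W : Type u₂) [Category.{v} W] [Preadditive W] [Linear k W]
    (Z : Type u₃) [Category.{v} Z] [Preadditive Z] [Linear k Z] : ObjectProperty (V × W ⥤ Z) :=
  fun F => (∀ X : V, isLin k W Z (Prod.sectR X W ⋙ F)) ∧
    (∀ Y : W, isLin k V Z (Prod.sectL V Y ⋙ F))

/-- The category of `k`-bilinear functors and natural transformations. -/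
abbrev BilFun (V : Type u₁) [Category.{v} V] [Preadditive V] [Linear k V]
    (W : Type u₂) [Category.{v} W] [Preadditive W] [Linear k W]
    (Z : Type u₃) [Category.{v} Z] [Preadditive Z] [Linear k Z] :=
  (isBil k V W Z).FullSubcategory

/-- Right exact linear functors. -/
def isRex (C : Type u₁) [Category.{v} C] [Preadditive C] [Linear k C]
    (D : Type u₂) [Category.{v'} D] [Preadditive D] [Linear k D] : ObjectProperty (C ⥤ D) :=
  fun F => isLin k C D F ∧ PreservesFiniteColimits F

/-- The category of right exact `k`-linear functors and natural transformations. -/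
abbrev RexFun (C : Type u₁) [Category.{v} C] [Preadditive C] [Linear k C]
    (D : Type u₂) [Category.{v'} D] [Preadditive D] [Linear k D] :=
  (isRex k C D).FullSubcategory

/-- Functors on a product of categories that are `k`-linear and right exact in each variable. -/
def isBirex (A : Type u₁) [Category.{v} A] [Preadditive A] [Linear k A]
    (B : Type u₂) [Category.{v} B] [Preadditive B] [Linear k B]
    (Z : Type u₃) [Category.{v} Z] [Preadditive Z] [Linear k Z] : ObjectProperty (A × B ⥤ Z) :=
  fun F => (∀ X : A, isRex k B Z (Prod.sectR X B ⋙ F)) ∧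
    (∀ Y : B, isRex k A Z (Prod.sectL A Y ⋙ F))

/-- The category of `k`-bilinear functors that are right exact in each variable. -/
abbrev BirexFun (A : Type u₁) [Category.{v} A] [Preadditive A] [Linear k A]
    (B : Type u₂) [Category.{v} B] [Preadditive B] [Linear k B]
    (Z : Type u₃) [Category.{v} Z] [Preadditive Z] [Linear k Z] :=
  (isBirex k A B Z).FullSubcategory

/-- Forgetting right exactness. -/
abbrev rexToLin (C : Type u₁) [Category.{v} C] [Preadditive C] [Linear k C]
    (D : Type u₂) [Category.{v'} D] [Preadditive D] [Linear k D] : RexFun k C D ⥤ LinFun k C D :=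
  ObjectProperty.ιOfLE (fun _ h => h.1)

end Functors

/-! ### The categorical trace -/

section Trace

variable (k : Type u') [Field k] (C : Type u) [Category.{v} C] [Preadditive C] [Linear k C]

/-- The categorical trace of an endofunctor: the space of natural transformations from the
identity functor to it. -/
abbrev ttr {C : Type u} [Category.{v} C] (g : C ⥤ C) := 𝟭 C ⟶ g

/-- The categorical trace as a functor of the endofunctor; a natural transformation `g ⟶ g'` acts
by composition. -/
abbrev ttrFunctor : (C ⥤ C) ⥤ ModuleCat.{max u v} k :=
  (linearCoyoneda k (C ⥤ C)).obj (Opposite.op (𝟭 C))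

end Trace

lemma map_mkHom {V W T : Type*} [Category* V] [Category* W] [Category* T]
    (B : V × W ⥤ T) {X X' : V} {Y Y' : W} (f : X ⟶ X') (g : Y ⟶ Y') :
    B.map (Prod.mkHom f g) = B.map (Prod.mkHom f (𝟙 Y)) ≫ B.map (Prod.mkHom (𝟙 X') g) := by
  rw [← B.map_comp]
  exact congrArg B.map (Prod.hom_ext (Category.comp_id _).symm (Category.id_comp _).symm)

/-! ### The tensor product of linear categories -/

section Linear

variable (k : Type u') [Field k]
  {V : Type u₁} [Category.{v} V] [Preadditive V] [Linear k V]
  {W : Type u₂} [Category.{v} W] [Preadditive W] [Linear k W]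
  {T : Type u₃} [Category.{v} T] [Preadditive T] [Linear k T]

variable {k} in
lemma isLin.comp {C D E : Type*} [Category* C] [Category* D] [Category* E]
    [Preadditive C] [Preadditive D] [Preadditive E] [Linear k C] [Linear k D] [Linear k E]
    {F : C ⥤ D} {G : D ⥤ E} (hF : isLin k C D F) (hG : isLin k D E G) :
    isLin k C E (F ⋙ G) := by
  obtain ⟨_, _⟩ := hF
  obtain ⟨_, _⟩ := hG
  exact ⟨inferInstance, inferInstance⟩

lemma isLin_id : isLin k V V (𝟭 V) := ⟨inferInstance, inferInstance⟩

variable {k} in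
lemma isBil.comp {Z : Type*} [Category.{v} Z] [Preadditive Z] [Linear k Z]
    {B : V × W ⥤ T} (hB : isBil k V W T B) {F : T ⥤ Z} (hF : isLin k T Z F) :
    isBil k V W Z (B ⋙ F) :=
  ⟨fun X => (hB.1 X).comp hF, fun Y => (hB.2 Y).comp hF⟩

/-- Restricting `B ∘ (g × h)` to a fixed first variable. -/
def sectRProdIso (B : V × W ⥤ T) (g : V ⥤ V) (h : W ⥤ W) (X : V) :
    Prod.sectR X W ⋙ g.prod h ⋙ B ≅ h ⋙ Prod.sectR (g.obj X) W ⋙ B :=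
  NatIso.ofComponents (fun _ => Iso.refl _) (fun f => by
    change B.map _ ≫ 𝟙 _ = 𝟙 _ ≫ B.map _
    rw [Category.comp_id, Category.id_comp]
    exact congrArg B.map (Prod.hom_ext (g.map_id X) rfl))

/-- Restricting `B ∘ (g × h)` to a fixed second variable. -/
def sectLProdIso (B : V × W ⥤ T) (g : V ⥤ V) (h : W ⥤ W) (Y : W) :
    Prod.sectL V Y ⋙ g.prod h ⋙ B ≅ g ⋙ Prod.sectL V (h.obj Y) ⋙ B :=
  NatIso.ofComponents (fun _ => Iso.refl _) (fun f => by
    change B.map _ ≫ 𝟙 _ = 𝟙 _ ≫ B.map _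
    rw [Category.comp_id, Category.id_comp]
    exact congrArg B.map (Prod.hom_ext rfl (h.map_id Y)))

variable {k} in
lemma isBil.prod_comp {B : V × W ⥤ T} (hB : isBil k V W T B)
    {g : V ⥤ V} (hg : isLin k V V g) {h : W ⥤ W} (hh : isLin k W W h) :
    isBil k V W T (g.prod h ⋙ B) := by
  refine ⟨fun X => ?_, fun Y => ?_⟩
  · obtain ⟨_, _⟩ := hh.comp (hB.1 (g.obj X))
    exact ⟨Functor.additive_of_iso (sectRProdIso B g h X).symm,
      Functor.linear_of_iso k (sectRProdIso B g h X).symm⟩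
  · obtain ⟨_, _⟩ := hg.comp (hB.2 (h.obj Y))
    exact ⟨Functor.additive_of_iso (sectLProdIso B g h Y).symm,
      Functor.linear_of_iso k (sectLProdIso B g h Y).symm⟩

variable {k} in
/-- Precomposition with a bilinear functor `V × W ⥤ T`, from linear functors on `T` to bilinear
functors on `V × W`. -/
def precomp {B : V × W ⥤ T} (hB : isBil k V W T B)
    (Z : Type w) [Category.{v} Z] [Preadditive Z] [Linear k Z] :
    LinFun k T Z ⥤ BilFun k V W Z :=
  (isBil k V W Z).lift ((isLin k T Z).ι ⋙ (Functor.whiskeringLeft (V × W) T Z).obj B)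
    (fun F => hB.comp F.property)

/-- `B : V × W ⥤ T` exhibits the additive `k`-linear category `T` as the (uncompleted) tensor
product of the linear categories `V` and `W`: it is bilinear, and for every additive `k`-linear
category `Z`, precomposition with `B` is an equivalence from linear functors on `T` to bilinear
functors on `V × W`. -/
structure IsLinearTensor (V : Type u₁) [Category.{v} V] [Preadditive V] [Linear k V]
    (W : Type u₂) [Category.{v} W] [Preadditive W] [Linear k W]
    (T : Type w) [Category.{v} T] [Preadditive T] [HasFiniteBiproducts T] [Linear k T]
    (B : V × W ⥤ T) : Prop where
  bilinear : isBil k V W T B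
  universal : ∀ (Z : Type w) [Category.{v} Z] [Preadditive Z] [HasFiniteBiproducts Z]
    [Linear k Z], (precomp bilinear Z).IsEquivalence

variable {k} in
/-- The functor `(g, h) ↦ ⊠ ∘ (g × h)`. -/
def extProd {B : V × W ⥤ T} (hB : isBil k V W T B) :
    LinFun k V V × LinFun k W W ⥤ BilFun k V W T where
  obj p := ⟨p.1.obj.prod p.2.obj ⋙ B, hB.prod_comp p.1.property p.2.property⟩
  map f := ObjectProperty.homMk (Functor.whiskerRight (NatTrans.prod f.1.hom f.2.hom) B)
  map_id p := by
    ext x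
    exact B.map_id _
  map_comp f f' := by
    ext x
    exact B.map_comp (Prod.mkHom (f.1.hom.app x.1) (f.2.hom.app x.2))
      (Prod.mkHom (f'.1.hom.app x.1) (f'.2.hom.app x.2))

variable {k} in
lemma isBil.map_add_left {B : V × W ⥤ T} (hB : isBil k V W T B) {X X' : V} {Y Y' : W}
    (f f' : X ⟶ X') (g : Y ⟶ Y') :
    B.map (Prod.mkHom (f + f') g) = B.map (Prod.mkHom f g) + B.map (Prod.mkHom f' g) := by
  have := (hB.2 Y).1
  have h : B.map (Prod.mkHom (f + f') (𝟙 Y)) =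
      B.map (Prod.mkHom f (𝟙 Y)) + B.map (Prod.mkHom f' (𝟙 Y)) :=
    (Prod.sectL V Y ⋙ B).map_add (f := f) (g := f')
  rw [map_mkHom B (f + f'), map_mkHom B f, map_mkHom B f', h, Preadditive.add_comp]

variable {k} in
lemma isBil.map_smul_left {B : V × W ⥤ T} (hB : isBil k V W T B) {X X' : V} {Y Y' : W}
    (c : k) (f : X ⟶ X') (g : Y ⟶ Y') :
    B.map (Prod.mkHom (c • f) g) = c • B.map (Prod.mkHom f g) := by
  have := (hB.2 Y).2
  have h : B.map (Prod.mkHom (c • f) (𝟙 Y)) = c • B.map (Prod.mkHom f (𝟙 Y)) :=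
    (Prod.sectL V Y ⋙ B).map_smul c f
  rw [map_mkHom B (c • f), map_mkHom B f, h, Linear.smul_comp]

variable {k} in
lemma isBil.map_add_right {B : V × W ⥤ T} (hB : isBil k V W T B) {X X' : V} {Y Y' : W}
    (f : X ⟶ X') (g g' : Y ⟶ Y') :
    B.map (Prod.mkHom f (g + g')) = B.map (Prod.mkHom f g) + B.map (Prod.mkHom f g') := by
  have := (hB.1 X').1
  have h : B.map (Prod.mkHom (𝟙 X') (g + g')) =
      B.map (Prod.mkHom (𝟙 X') g) + B.map (Prod.mkHom (𝟙 X') g') :=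
    (Prod.sectR X' W ⋙ B).map_add (f := g) (g := g')
  rw [map_mkHom B f (g + g'), map_mkHom B f g, map_mkHom B f g', h, Preadditive.comp_add]

variable {k} in
lemma isBil.map_smul_right {B : V × W ⥤ T} (hB : isBil k V W T B) {X X' : V} {Y Y' : W}
    (c : k) (f : X ⟶ X') (g : Y ⟶ Y') :
    B.map (Prod.mkHom f (c • g)) = c • B.map (Prod.mkHom f g) := by
  have := (hB.1 X').2
  have h : B.map (Prod.mkHom (𝟙 X') (c • g)) = c • B.map (Prod.mkHom (𝟙 X') g) :=
    (Prod.sectR X' W ⋙ B).map_smul c g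
  rw [map_mkHom B f (c • g), map_mkHom B f g, h, Linear.comp_smul]

instance precomp_additive {B : V × W ⥤ T} (hB : isBil k V W T B)
    (Z : Type w) [Category.{v} Z] [Preadditive Z] [Linear k Z] : (precomp hB Z).Additive where
  map_add := rfl

instance precomp_linear {B : V × W ⥤ T} (hB : isBil k V W T B)
    (Z : Type w) [Category.{v} Z] [Preadditive Z] [Linear k Z] : (precomp hB Z).Linear k where
  map_smul _ _ := rfl

namespace IsLinearTensor

variable {k} [HasFiniteBiproducts T] {B : V × W ⥤ T} (hB : IsLinearTensor k V W T B)

/-- The equivalence of the universal property, in the case `Z = T`. -/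
def selfEquiv : LinFun k T T ≌ BilFun k V W T :=
  haveI := hB.universal T
  (precomp hB.bilinear T).asEquivalence

/-- The functor `(g, h) ↦ g ⊠ h` on pairs of linear endofunctors: `g ⊠ h` is the linear
endofunctor of `T` that the universal property assigns to the bilinear functor `⊠ ∘ (g × h)`. -/
def box : LinFun k V V × LinFun k W W ⥤ LinFun k T T :=
  extProd hB.bilinear ⋙ hB.selfEquiv.inverse

/-- The natural isomorphism `⊠ ∘ (g × h) ≅ (g ⊠ h) ∘ ⊠`, natural in `(g, h)`. -/
def iotaIso : extProd hB.bilinear ≅ hB.box ⋙ precomp hB.bilinear T :=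
  Functor.isoWhiskerLeft (extProd hB.bilinear) hB.selfEquiv.counitIso.symm

/-- The identity functor as a linear functor. -/
abbrev idLin (k : Type u') [Field k] (C : Type u) [Category.{v} C] [Preadditive C] [Linear k C] :
    LinFun k C C := ⟨𝟭 C, isLin_id k⟩

/-- The isomorphism `id ⊠ id ≅ id`, compatible with `iotaIso`. -/
def kappaOne : hB.box.obj (idLin k V, idLin k W) ≅ idLin k T :=
  hB.selfEquiv.inverse.mapIso
    (ObjectProperty.isoMk _ (Iso.refl B) :
      (extProd hB.bilinear).obj (idLin k V, idLin k W) ≅ hB.selfEquiv.functor.obj (idLin k T)) ≪≫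
    (hB.selfEquiv.unitIso.app (idLin k T)).symm

/-- The natural transformation `φ ⊠ ψ : id ⊠ id ⟶ g ⊠ h`. -/
abbrev boxMap {g : LinFun k V V} {h : LinFun k W W} (φ : ttr g.obj) (ψ : ttr h.obj) :
    hB.box.obj (idLin k V, idLin k W) ⟶ hB.box.obj (g, h) :=
  hB.box.map (Prod.mkHom (ObjectProperty.homMk φ : idLin k V ⟶ g)
    (ObjectProperty.homMk ψ : idLin k W ⟶ h))

instance : hB.selfEquiv.inverse.Additive :=
  haveI : hB.selfEquiv.functor.Additive := precomp_additive k hB.bilinear T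
  inferInstance

instance : hB.selfEquiv.inverse.Linear k :=
  haveI : hB.selfEquiv.functor.Additive := precomp_additive k hB.bilinear T
  haveI : hB.selfEquiv.functor.Linear k := precomp_linear k hB.bilinear T
  inferInstance

/-- The bilinear map `(φ, ψ) ↦ (φ ⊠ ψ) ∘ kappaOne⁻¹` from `ttr g × ttr h` to `ttr (g ⊠ h)`. -/
def muBilin (g : LinFun k V V) (h : LinFun k W W) :
    ttr g.obj →ₗ[k] ttr h.obj →ₗ[k] ttr (hB.box.obj (g, h)).obj :=
  LinearMap.mk₂ k (fun φ ψ => (hB.kappaOne.inv ≫ hB.boxMap φ ψ).hom)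
    (fun φ φ' ψ => by
      have e : hB.boxMap (φ + φ') ψ = hB.boxMap φ ψ + hB.boxMap φ' ψ :=
        (congrArg hB.selfEquiv.inverse.map (by ext x; exact hB.bilinear.map_add_left _ _ _)).trans
          (Functor.map_add hB.selfEquiv.inverse)
      rw [e, Preadditive.comp_add]
      rfl)
    (fun c φ ψ => by
      have e : hB.boxMap (c • φ) ψ = c • hB.boxMap φ ψ :=
        (congrArg hB.selfEquiv.inverse.map (by ext x; exact hB.bilinear.map_smul_left _ _ _)).trans
          (Functor.map_smul hB.selfEquiv.inverse _ _)
      rw [e, Linear.comp_smul]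
      rfl)
    (fun φ ψ ψ' => by
      have e : hB.boxMap φ (ψ + ψ') = hB.boxMap φ ψ + hB.boxMap φ ψ' :=
        (congrArg hB.selfEquiv.inverse.map (by ext x; exact hB.bilinear.map_add_right _ _ _)).trans
          (Functor.map_add hB.selfEquiv.inverse)
      rw [e, Preadditive.comp_add]
      rfl)
    (fun c φ ψ => by
      have e : hB.boxMap φ (c • ψ) = c • hB.boxMap φ ψ :=
        (congrArg hB.selfEquiv.inverse.map (by ext x; exact hB.bilinear.map_smul_right _ _ _)).trans
          (Functor.map_smul hB.selfEquiv.inverse _ _)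
      rw [e, Linear.comp_smul]
      rfl)

/-- The canonical map `ttr g ⊗ ttr h → ttr (g ⊠ h)`. -/
def mu (g : LinFun k V V) (h : LinFun k W W) :
    ttr g.obj ⊗[k] ttr h.obj →ₗ[k] ttr (hB.box.obj (g, h)).obj :=
  TensorProduct.lift (hB.muBilin g h)

end IsLinearTensor

end Linear

/-! ### The Deligne tensor product of abelian categories -/

section Abelian

variable (k : Type u') [Field k]

/-- An object of an abelian category has finite length if its lattice of subobjects contains a
finite chain from `0` to the whole object that admits no refinement (a composition series). -/
def HasFiniteLength {C : Type u} [Category.{v} C] [Abelian C] (X : C) : Prop :=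
  ∃ s : RelSeries {p : Subobject X × Subobject X | p.1 ⋖ p.2}, s.head = ⊥ ∧ s.last = ⊤

/-- Deligne's finiteness condition: all objects have finite length and all spaces of morphisms
are finite-dimensional. -/
structure DeligneFinite (C : Type u) [Category.{v} C] [Abelian C] [Linear k C] : Prop where
  finiteLength : ∀ X : C, HasFiniteLength X
  finiteDim : ∀ X Y : C, FiniteDimensional k (X ⟶ Y)

variable {A : Type u₁} [Category.{v} A] [Abelian A] [Linear k A]
  {B : Type u₂} [Category.{v} B] [Abelian B] [Linear k B]
  {T : Type u₃} [Category.{v} T] [Abelian T] [Linear k T]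

variable {k} in
lemma isRex.comp {C D E : Type*} [Category* C] [Category* D] [Category* E]
    [Preadditive C] [Preadditive D] [Preadditive E] [Linear k C] [Linear k D] [Linear k E]
    {F : C ⥤ D} {G : D ⥤ E} (hF : isRex k C D F) (hG : isRex k D E G) :
    isRex k C E (F ⋙ G) := by
  obtain ⟨hF, _⟩ := hF
  obtain ⟨hG, _⟩ := hG
  exact ⟨hF.comp hG, comp_preservesFiniteColimits _ _⟩

variable {k} in
lemma isRex.of_iso {C D : Type*} [Category* C] [Category* D]
    [Preadditive C] [Preadditive D] [Linear k C] [Linear k D]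
    {F G : C ⥤ D} (e : F ≅ G) (hF : isRex k C D F) : isRex k C D G := by
  obtain ⟨⟨_, _⟩, _⟩ := hF
  exact ⟨⟨Functor.additive_of_iso e, Functor.linear_of_iso k e⟩,
    preservesFiniteColimits_of_natIso e⟩

variable {k} in
lemma isBirex.comp {Z : Type*} [Category.{v} Z] [Preadditive Z] [Linear k Z]
    {M : A × B ⥤ T} (hM : isBirex k A B T M) {F : T ⥤ Z} (hF : isRex k T Z F) :
    isBirex k A B Z (M ⋙ F) :=
  ⟨fun X => (hM.1 X).comp hF, fun Y => (hM.2 Y).comp hF⟩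

variable {k} in
lemma isBirex.prod_comp {M : A × B ⥤ T} (hM : isBirex k A B T M)
    {g : A ⥤ A} (hg : isRex k A A g) {h : B ⥤ B} (hh : isRex k B B h) :
    isBirex k A B T (g.prod h ⋙ M) :=
  ⟨fun X => (hh.comp (hM.1 (g.obj X))).of_iso (sectRProdIso M g h X).symm,
    fun Y => (hg.comp (hM.2 (h.obj Y))).of_iso (sectLProdIso M g h Y).symm⟩

variable {k} in
/-- Precomposition with a bilinear functor `A × B ⥤ T` that is right exact in each variable. -/
def precompRex {M : A × B ⥤ T} (hM : isBirex k A B T M)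
    (Z : Type w) [Category.{v} Z] [Preadditive Z] [Linear k Z] :
    RexFun k T Z ⥤ BirexFun k A B Z :=
  (isBirex k A B Z).lift ((isRex k T Z).ι ⋙ (Functor.whiskeringLeft (A × B) T Z).obj M)
    (fun F => hM.comp F.property)

/-- `M : A × B ⥤ T` exhibits the `k`-linear abelian category `T` as the Deligne tensor product of
the `k`-linear abelian categories `A` and `B`: it is bilinear and right exact in each variable, and
for every `k`-linear abelian category `Z`, precomposition with `M` is an equivalence from right
exact linear functors on `T` to bilinear functors on `A × B` that are right exact in each
variable. -/
structure IsDeligneTensor (A : Type u₁) [Category.{v} A] [Abelian A] [Linear k A]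
    (B : Type u₂) [Category.{v} B] [Abelian B] [Linear k B]
    (T : Type w) [Category.{v} T] [Abelian T] [Linear k T]
    (M : A × B ⥤ T) : Prop where
  birex : isBirex k A B T M
  universal : ∀ (Z : Type w) [Category.{v} Z] [Abelian Z] [Linear k Z],
    (precompRex birex Z).IsEquivalence

variable {k} in
/-- The functor `(g, h) ↦ M ∘ (g × h)` for right exact `g` and `h`. -/
def extProdRex {M : A × B ⥤ T} (hM : isBirex k A B T M) :
    RexFun k A A × RexFun k B B ⥤ BirexFun k A B T where
  obj p := ⟨p.1.obj.prod p.2.obj ⋙ M, hM.prod_comp p.1.property p.2.property⟩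
  map f := ObjectProperty.homMk (Functor.whiskerRight (NatTrans.prod f.1.hom f.2.hom) M)
  map_id p := by
    ext x
    exact M.map_id _
  map_comp f f' := by
    ext x
    exact M.map_comp (Prod.mkHom (f.1.hom.app x.1) (f.2.hom.app x.2))
      (Prod.mkHom (f'.1.hom.app x.1) (f'.2.hom.app x.2))

namespace IsDeligneTensor

variable {k} {M : A × B ⥤ T} (hM : IsDeligneTensor k A B T M)

/-- The equivalence of the universal property, in the case `Z = T`. -/
def selfEquiv : RexFun k T T ≌ BirexFun k A B T :=
  haveI := hM.universal T
  (precompRex hM.birex T).asEquivalence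

/-- The functor sending right exact linear endofunctors `(g, h)` to the right exact linear
endofunctor of the Deligne tensor product that the universal property assigns to the functor
`M ∘ (g × h)`. -/
def box : RexFun k A A × RexFun k B B ⥤ RexFun k T T :=
  extProdRex hM.birex ⋙ hM.selfEquiv.inverse

end IsDeligneTensor

variable (A B) in
/-- The pairs `(g, h)` of right exact linear endofunctors such that at least one of the
categorical traces of `g` and `h` is finite-dimensional. -/
def finiteTracePairs : ObjectProperty (RexFun k A A × RexFun k B B) :=
  fun p => FiniteDimensional k (ttr p.1.obj) ∨ FiniteDimensional k (ttr p.2.obj)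

end Abelian

end CatTrace

end

/-!
Everything rests on one fact about a universal bilinear functor `B : V × W ⥤ T`, valid both for the
tensor product of linear categories and for the Deligne tensor product: the map
`Hom(X, X') ⊗ Hom(Y, Y') → Hom(B(X, Y), B(X', Y'))` is bijective
(`IsLinearTensor.bijective_homComparison`, `IsDeligneTensor.bijective_homComparison`).
For fixed `X'` and `Y'`, the source is a bilinear functor of `(X, Y)` with values in the opposite of
the category of vector spaces, and it is right exact in each variable, since `Hom` is left exact and
tensoring over a field is exact. By the universal property it extends to a functor `F` on `T`, and
the map in question extends to a natural transformation between `F` and the representable functor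
`Hom(-, B(X', Y'))`, which is right exact for the same reason. The Yoneda lemma, applied to
`𝟙 ⊗ 𝟙 ∈ F(B(X', Y'))`, gives a map in the other direction, and the two maps are inverse to each
other on the objects `B(X, Y)`. No finiteness condition enters here; neither the existence of the
tensor products nor a model of them is needed.

The universal property also identifies the trace of `g ⊠ h` with the natural transformations
`B ⟶ B ∘ (g × h)` (`bijective_restrictTrace`), and likewise for the Deligne tensor product. By the
first fact these are the families in `Hom(X, g X) ⊗ Hom(Y, h Y)` natural in `X` and in `Y`.

For the first part, `ttr g` is the space of solutions of a system of linear equations in the spaces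
`Hom(X, g X)`, and passing to solutions commutes with tensoring with a finite-dimensional space.
Using this for `Hom(Y, h Y)` in one variable and then for `ttr g` in the other (or with the roles of
`g` and `h` exchanged) shows that the families are `ttr g ⊗ ttr h` (`bijective_ttrTensor`).
For the second part, the families natural in `X` and `Y` are the same for both tensor products, and
the resulting isomorphism is compatible with natural transformations of `g` and `h` (`traceIso`).
-/

noncomputable section

namespace CatTrace

/-! ### The test category

The universal properties quantify over categories in a fixed universe, so the opposite of the
category of vector spaces has to be lifted to it before they apply. -/

/-- The opposite of a `k`-linear category is `k`-linear. -/
instance linearOpposite (k : Type u') [Field k] (C : Type u) [Category.{v} C] [Preadditive C]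
    [Linear k C] : Linear k Cᵒᵖ where
  homModule _ _ :=
    { smul := fun c f => (c • f.unop).op
      one_smul := fun f => Quiver.Hom.unop_inj (one_smul k f.unop)
      mul_smul := fun a b f => Quiver.Hom.unop_inj (mul_smul a b f.unop)
      smul_zero := fun a => Quiver.Hom.unop_inj (smul_zero a)
      smul_add := fun a f g => Quiver.Hom.unop_inj (smul_add a f.unop g.unop)
      add_smul := fun a b f => Quiver.Hom.unop_inj (add_smul a b f.unop)
      zero_smul := fun f => Quiver.Hom.unop_inj (zero_smul k f.unop) }
  smul_comp _ _ _ c f g := Quiver.Hom.unop_inj (Linear.comp_smul _ _ _ g.unop c f.unop)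
  comp_smul _ _ _ f c g := Quiver.Hom.unop_inj (Linear.smul_comp _ _ _ c g.unop f.unop)

lemma isLin_rightOp {k : Type u'} [Field k] {C : Type u} [Category.{v} C] [Preadditive C]
    [Linear k C] {D : Type u₁} [Category.{v'} D] [Preadditive D] [Linear k D] {F : Cᵒᵖ ⥤ D}
    (hF : isLin k Cᵒᵖ D F) : isLin k C Dᵒᵖ F.rightOp := by
  obtain ⟨_, hl⟩ := hF
  exact ⟨inferInstance, ⟨fun f r => congrArg Quiver.Hom.op (hl.map_smul f.op r)⟩⟩

attribute [local instance] uliftCategory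

instance preadditiveULift (C : Type u) [Category.{v} C] [Preadditive C] :
    Preadditive (ULift.{w} C) where
  homGroup X Y := inferInstanceAs (AddCommGroup (X.down ⟶ Y.down))
  add_comp X Y Z := Preadditive.add_comp X.down Y.down Z.down
  comp_add X Y Z := Preadditive.comp_add X.down Y.down Z.down

instance linearULift (k : Type u') [Field k] (C : Type u) [Category.{v} C] [Preadditive C]
    [Linear k C] : Linear k (ULift.{w} C) where
  homModule X Y := inferInstanceAs (Module k (X.down ⟶ Y.down))
  smul_comp X Y Z := Linear.smul_comp X.down Y.down Z.down
  comp_smul X Y Z := Linear.comp_smul X.down Y.down Z.down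

instance upFunctor_isEquivalence (C : Type u) [Category.{v} C] :
    (ULift.upFunctor : C ⥤ ULift.{w} C).IsEquivalence :=
  inferInstanceAs ULift.equivalence.functor.IsEquivalence

instance downFunctor_isEquivalence (C : Type u) [Category.{v} C] :
    (ULift.downFunctor : ULift.{w} C ⥤ C).IsEquivalence :=
  inferInstanceAs ULift.equivalence.inverse.IsEquivalence

instance abelianULift (C : Type u) [Category.{v} C] [Abelian C] : Abelian (ULift.{w} C) :=
  haveI : HasFiniteProducts (ULift.{w} C) :=
    ⟨fun _ => Adjunction.hasLimitsOfShape_of_equivalence ULift.downFunctor⟩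
  abelianOfEquivalence (ULift.downFunctor : ULift.{w} C ⥤ C)

lemma isRex_upFunctor (k : Type u') [Field k] (C : Type u) [Category.{v} C] [Preadditive C]
    [Linear k C] : isRex k C (ULift.{w} C) ULift.upFunctor :=
  ⟨⟨⟨rfl⟩, ⟨fun _ _ => rfl⟩⟩, inferInstance⟩

/-! ### The tensor product of representable functors -/

section HomTensor

variable {k : Type v} [Field k]

lemma isLin_linearYoneda_obj (C : Type u) [Category.{v} C] [Preadditive C] [Linear k C] (X : C) :
    isLin k Cᵒᵖ (ModuleCat.{v} k) ((linearYoneda k C).obj X) :=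
  ⟨inferInstance, ⟨fun f r => by
    ext g
    exact Linear.smul_comp _ _ _ r f.unop g⟩⟩

instance preservesLimits_linearYoneda_obj (C : Type u) [Category.{v} C] [Preadditive C]
    [Linear k C] (X : C) : PreservesLimits ((linearYoneda k C).obj X) :=
  haveI : PreservesLimits
      ((linearYoneda k C).obj X ⋙ forget₂ (ModuleCat.{v} k) AddCommGrpCat.{v}) :=
    inferInstanceAs (PreservesLimits (preadditiveYoneda.obj X))
  preservesLimits_of_reflects_of_preserves _ (forget₂ (ModuleCat.{v} k) AddCommGrpCat.{v})

/-- `Hom(-, X)`, as a functor to the opposite of the category of vector spaces, is right exact. -/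
lemma isRex_linearYoneda_rightOp {C : Type u} [Category.{v} C] [Preadditive C] [Linear k C]
    (X : C) : isRex k C (ModuleCat.{v} k)ᵒᵖ ((linearYoneda k C).obj X).rightOp :=
  ⟨isLin_rightOp (isLin_linearYoneda_obj C X), preservesFiniteColimits_rightOp _⟩

/-- Tensoring with a fixed vector space, seen on the opposite categories, is right exact. -/
lemma isRex_tensorLeft_op (M : ModuleCat.{v} k) :
    isRex k (ModuleCat.{v} k)ᵒᵖ (ModuleCat.{v} k)ᵒᵖ (MonoidalCategory.tensorLeft M).op :=
  ⟨⟨inferInstance, ⟨fun f r => congrArg Quiver.Hom.op (by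
    ext : 1
    exact LinearMap.lTensor_smul M r f.unop.hom)⟩⟩, preservesFiniteColimits_op _⟩

lemma isRex_tensorRight_op (M : ModuleCat.{v} k) :
    isRex k (ModuleCat.{v} k)ᵒᵖ (ModuleCat.{v} k)ᵒᵖ (MonoidalCategory.tensorRight M).op :=
  ⟨⟨inferInstance, ⟨fun f r => congrArg Quiver.Hom.op (by
    ext : 1
    exact LinearMap.rTensor_smul M r f.unop.hom)⟩⟩, preservesFiniteColimits_op _⟩

variable {V : Type u₁} [Category.{v} V] [Preadditive V] [Linear k V]
  {W : Type u₂} [Category.{v} W] [Preadditive W] [Linear k W]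

variable (k) in
/-- The functor `(X, Y) ↦ Hom(X, X') ⊗ Hom(Y, Y')` with values in the opposite of the category of
vector spaces. -/
def homTensor (X' : V) (Y' : W) : V × W ⥤ (ModuleCat.{v} k)ᵒᵖ where
  obj p := .op (ModuleCat.of k ((p.1 ⟶ X') ⊗[k] (p.2 ⟶ Y')))
  map f := (ModuleCat.ofHom (TensorProduct.map (Linear.leftComp k X' f.1)
    (Linear.leftComp k Y' f.2))).op
  map_id p := Quiver.Hom.unop_inj (by
    ext : 1
    refine TensorProduct.ext' fun a b => ?_
    change (𝟙 p.1 ≫ a) ⊗ₜ[k] (𝟙 p.2 ≫ b) = a ⊗ₜ[k] b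
    rw [Category.id_comp, Category.id_comp])
  map_comp f f' := Quiver.Hom.unop_inj (by
    ext : 1
    refine TensorProduct.ext' fun a b => ?_
    change ((f.1 ≫ f'.1) ≫ a) ⊗ₜ[k] ((f.2 ≫ f'.2) ≫ b) =
      (f.1 ≫ f'.1 ≫ a) ⊗ₜ[k] (f.2 ≫ f'.2 ≫ b)
    rw [Category.assoc, Category.assoc])

/-- `Hom(X, X') ⊗ Hom(-, Y')` is a representable functor followed by an exact one. -/
def sectRHomTensorIso (X' : V) (Y' : W) (X : V) :
    ((linearYoneda k W).obj Y').rightOp ⋙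
        (MonoidalCategory.tensorLeft (ModuleCat.of k (X ⟶ X'))).op ≅
      Prod.sectR X W ⋙ homTensor k X' Y' :=
  NatIso.ofComponents (fun _ => Iso.refl _) (fun {Y Y₁} f => Quiver.Hom.unop_inj (by
    ext : 1
    exact TensorProduct.ext' fun (a : X ⟶ X') (b : Y₁ ⟶ Y') =>
      congrArg (· ⊗ₜ[k] (f ≫ b)) (Category.id_comp a).symm))

/-- `Hom(-, X') ⊗ Hom(Y, Y')` is a representable functor followed by an exact one. -/
def sectLHomTensorIso (X' : V) (Y' : W) (Y : W) :
    ((linearYoneda k V).obj X').rightOp ⋙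
        (MonoidalCategory.tensorRight (ModuleCat.of k (Y ⟶ Y'))).op ≅
      Prod.sectL V Y ⋙ homTensor k X' Y' :=
  NatIso.ofComponents (fun _ => Iso.refl _) (fun {X X₁} f => Quiver.Hom.unop_inj (by
    ext : 1
    exact TensorProduct.ext' fun (a : X₁ ⟶ X') (b : Y ⟶ Y') =>
      congrArg ((f ≫ a) ⊗ₜ[k] ·) (Category.id_comp b).symm))

lemma isRex_sectR_homTensor (X' : V) (Y' : W) (X : V) :
    isRex k W (ModuleCat.{v} k)ᵒᵖ (Prod.sectR X W ⋙ homTensor k X' Y') :=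
  ((isRex_linearYoneda_rightOp Y').comp (isRex_tensorLeft_op _)).of_iso
    (sectRHomTensorIso X' Y' X)

lemma isRex_sectL_homTensor (X' : V) (Y' : W) (Y : W) :
    isRex k V (ModuleCat.{v} k)ᵒᵖ (Prod.sectL V Y ⋙ homTensor k X' Y') :=
  ((isRex_linearYoneda_rightOp X').comp (isRex_tensorRight_op _)).of_iso
    (sectLHomTensorIso X' Y' Y)

end HomTensor

/-! ### Morphisms between pure tensors -/

section Comparison

variable {k : Type u'} [Field k]
  {V : Type u₁} [Category.{v} V] [Preadditive V] [Linear k V]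
  {W : Type u₂} [Category.{v} W] [Preadditive W] [Linear k W]
  {T : Type u₃} [Category.{v} T] [Preadditive T] [Linear k T]
  {B : V × W ⥤ T} (hB : isBil k V W T B)

/-- The linear map `Hom(X, X') ⊗ Hom(Y, Y') → Hom(B(X, Y), B(X', Y'))` induced by a bilinear
functor `B`. -/
def homComparison (p q : V × W) : (p.1 ⟶ q.1) ⊗[k] (p.2 ⟶ q.2) →ₗ[k] (B.obj p ⟶ B.obj q) :=
  TensorProduct.lift (LinearMap.mk₂ k
    (fun (f : p.1 ⟶ q.1) (g : p.2 ⟶ q.2) => B.map (Prod.mkHom f g))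
    (fun f f' g => hB.map_add_left f f' g) (fun c f g => hB.map_smul_left c f g)
    (fun f g g' => hB.map_add_right f g g') (fun c f g => hB.map_smul_right c f g))

/-- Precomposition with a morphism of pairs commutes with `homComparison`. -/
lemma homComparison_precomp {p p' q : V × W} (f : p ⟶ p') (x : (p'.1 ⟶ q.1) ⊗[k] (p'.2 ⟶ q.2)) :
    homComparison hB p q
        (TensorProduct.map (Linear.leftComp k q.1 f.1) (Linear.leftComp k q.2 f.2) x) =
      B.map f ≫ homComparison hB p' q x := by
  induction x with
  | zero => simp
  | add x y hx hy => rw [map_add, map_add, map_add, hx, hy, Preadditive.comp_add]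
  | tmul a b => exact B.map_comp f (Prod.mkHom a b)

/-- Postcomposition with a morphism of pairs commutes with `homComparison`. -/
lemma homComparison_postcomp {p q q' : V × W} (f : q ⟶ q') (x : (p.1 ⟶ q.1) ⊗[k] (p.2 ⟶ q.2)) :
    homComparison hB p q'
        (TensorProduct.map (Linear.rightComp k p.1 f.1) (Linear.rightComp k p.2 f.2) x) =
      homComparison hB p q x ≫ B.map f := by
  induction x with
  | zero => simp
  | add x y hx hy => rw [map_add, map_add, map_add, hx, hy, Preadditive.add_comp]
  | tmul a b => exact B.map_comp (Prod.mkHom a b) f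

end Comparison

section Yoneda

variable {k : Type v} [Field k]
  {V : Type u₁} [Category.{v} V] [Preadditive V] [Linear k V]
  {W : Type u₂} [Category.{v} W] [Preadditive W] [Linear k W]
  {T : Type u₃} [Category.{v} T] [Preadditive T] [Linear k T]
  {B : V × W ⥤ T} (hB : isBil k V W T B)

/-- The maps `homComparison` with a fixed target, as a natural transformation. -/
def homComparisonNat (q : V × W) :
    B ⋙ ((linearYoneda k T).obj (B.obj q)).rightOp ⟶ homTensor k q.1 q.2 where
  app p := (ModuleCat.ofHom (homComparison hB p q)).op
  naturality p p' f := Quiver.Hom.unop_inj (by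
    ext x
    exact (homComparison_precomp hB f x).symm)

/-- If the presheaf `Hom(-, X') ⊗ Hom(-, Y')` extends along `B` to a presheaf `F`, and the natural
map to `Hom(B(-), B(X', Y'))` extends to `F → Hom(-, B(X', Y'))`, then this natural map is
bijective: by the Yoneda lemma, `𝟙 ⊗ 𝟙` gives a map in the opposite direction. -/
lemma bijective_homComparison_of_extension (q : V × W) {F : T ⥤ (ModuleCat.{v} k)ᵒᵖ} [F.Additive]
    (e : B ⋙ F ≅ homTensor k q.1 q.2) (α : ((linearYoneda k T).obj (B.obj q)).rightOp ⟶ F)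
    (hα : Functor.whiskerLeft B α ≫ e.hom = homComparisonNat hB q) (p : V × W) :
    Function.Bijective (homComparison hB p q) := by
  have hα' (p : V × W) (x : (p.1 ⟶ q.1) ⊗[k] (p.2 ⟶ q.2)) :
      (α.app (B.obj p)).unop ((e.hom.app p).unop x) = homComparison hB p q x :=
    congr(($hα).app p |>.unop x)
  let x₀ : (F.obj (B.obj q)).unop :=
    (e.hom.app q).unop ((𝟙 q.1) ⊗ₜ[k] (𝟙 q.2) : (q.1 ⟶ q.1) ⊗[k] (q.2 ⟶ q.2))
  have hx₀ : (α.app (B.obj q)).unop x₀ = 𝟙 (B.obj q) := (hα' q _).trans (B.map_id q)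
  constructor
  · -- The Yoneda map of `x₀` composed with `homComparison` is the isomorphism `e`.
    have key (x : (p.1 ⟶ q.1) ⊗[k] (p.2 ⟶ q.2)) :
        (F.map (homComparison hB p q x)).unop x₀ = (e.hom.app p).unop x := by
      induction x with
      | zero =>
        rw [map_zero, F.map_zero]
        exact (map_zero (e.hom.app p).unop.hom).symm
      | add x y hx hy =>
        rw [map_add, F.map_add]
        exact (congrArg₂ (· + ·) hx hy).trans (map_add (e.hom.app p).unop.hom x y).symm
      | tmul a b =>
        have hn : (F.map (B.map (Prod.mkHom a b))).unop x₀ = (e.hom.app p).unop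
            ((a ≫ 𝟙 q.1) ⊗ₜ[k] (b ≫ 𝟙 q.2) : (p.1 ⟶ q.1) ⊗[k] (p.2 ⟶ q.2)) :=
          congr(($(e.hom.naturality (Prod.mkHom a b : p ⟶ q))).unop
            ((𝟙 q.1) ⊗ₜ[k] (𝟙 q.2) : (q.1 ⟶ q.1) ⊗[k] (q.2 ⟶ q.2)))
        rwa [Category.comp_id, Category.comp_id] at hn
    have he : Function.Injective (e.hom.app p).unop :=
      (ConcreteCategory.bijective_of_isIso (e.hom.app p).unop).1
    exact fun x y hxy => he (by rw [← key x, ← key y, hxy])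
  · -- By the Yoneda lemma, the Yoneda map of `x₀` followed by `α` is the identity.
    intro t
    obtain ⟨x, hx⟩ := (ConcreteCategory.bijective_of_isIso (e.hom.app p).unop).2
      ((F.map t).unop x₀)
    refine ⟨x, (hα' p x).symm.trans ?_⟩
    rw [hx]
    have hn : (α.app (B.obj p)).unop ((F.map t).unop x₀) = t ≫ (α.app (B.obj q)).unop x₀ :=
      congr(($(α.naturality t)).unop x₀).symm
    rw [hn, hx₀]
    exact Category.comp_id t

end Yoneda

section Universal

variable {k : Type v} [Field k]

/-- In the (uncompleted) tensor product of linear categories, the morphisms between pure tensors are the tensor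
products of the spaces of morphisms. -/
lemma IsLinearTensor.bijective_homComparison
    {V : Type u₁} [Category.{v} V] [Preadditive V] [Linear k V]
    {W : Type u₂} [Category.{v} W] [Preadditive W] [Linear k W]
    {T : Type (max w (v + 1))} [Category.{v} T] [Preadditive T] [HasFiniteBiproducts T]
    [Linear k T] {B : V × W ⥤ T} (hB : IsLinearTensor k V W T B) (p q : V × W) :
    Function.Bijective (homComparison hB.bilinear p q) := by
  let Z := ULift.{w} (ModuleCat.{v} k)ᵒᵖ
  have : HasFiniteBiproducts Z := Abelian.hasFiniteBiproducts
  have := hB.universal Z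
  let P := precomp hB.bilinear Z
  have up : isLin k (ModuleCat.{v} k)ᵒᵖ Z ULift.upFunctor := (isRex_upFunctor k _).1
  let H : BilFun k V W Z := ⟨homTensor k q.1 q.2 ⋙ ULift.upFunctor,
    fun X => (isRex_sectR_homTensor q.1 q.2 X).1.comp up,
    fun Y => (isRex_sectL_homTensor q.1 q.2 Y).1.comp up⟩
  let Y : LinFun k T Z := ⟨((linearYoneda k T).obj (B.obj q)).rightOp ⋙ ULift.upFunctor,
    (isRex_linearYoneda_rightOp _).1.comp up⟩
  let β : P.obj Y ⟶ H :=
    ObjectProperty.homMk (Functor.whiskerRight (homComparisonNat hB.bilinear q) ULift.upFunctor)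
  let e : P.obj (P.objPreimage H) ≅ H := P.objObjPreimageIso H
  let α : Y ⟶ P.objPreimage H := P.preimage (β ≫ e.inv)
  have hα : P.map α ≫ e.hom = β := by simp [α]
  have := (P.objPreimage H).property.1
  have hd : (ULift.downFunctor : Z ⥤ (ModuleCat.{v} k)ᵒᵖ).Additive := ⟨rfl⟩
  exact bijective_homComparison_of_extension hB.bilinear q
    (F := (P.objPreimage H).obj ⋙ ULift.downFunctor)
    (Functor.isoWhiskerRight ((isBil k V W Z).ι.mapIso e) ULift.downFunctor)
    (Functor.whiskerRight α.hom ULift.downFunctor)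
    (congrArg (fun f => Functor.whiskerRight ((isBil k V W Z).ι.map f) ULift.downFunctor) hα) p

/-- In the Deligne tensor product of abelian categories, the morphisms between pure tensors are the
tensor products of the spaces of morphisms: the presheaves `Hom(-, X')` and their tensor products
are right exact as functors to the opposite of the category of vector spaces. -/
lemma IsDeligneTensor.bijective_homComparison
    {V : Type u₁} [Category.{v} V] [Abelian V] [Linear k V]
    {W : Type u₂} [Category.{v} W] [Abelian W] [Linear k W]
    {T : Type (max w (v + 1))} [Category.{v} T] [Abelian T]
    [Linear k T] {B : V × W ⥤ T} (hB : IsDeligneTensor k V W T B)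
    (hB' : isBil k V W T B) (p q : V × W) :
    Function.Bijective (homComparison hB' p q) := by
  let Z := ULift.{w} (ModuleCat.{v} k)ᵒᵖ
  have := hB.universal Z
  let P := precompRex hB.birex Z
  have up : isRex k (ModuleCat.{v} k)ᵒᵖ Z ULift.upFunctor := isRex_upFunctor k _
  let H : BirexFun k V W Z := ⟨homTensor k q.1 q.2 ⋙ ULift.upFunctor,
    fun X => (isRex_sectR_homTensor q.1 q.2 X).comp up,
    fun Y => (isRex_sectL_homTensor q.1 q.2 Y).comp up⟩
  let Y : RexFun k T Z := ⟨((linearYoneda k T).obj (B.obj q)).rightOp ⋙ ULift.upFunctor,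
    (isRex_linearYoneda_rightOp _).comp up⟩
  let β : P.obj Y ⟶ H :=
    ObjectProperty.homMk (Functor.whiskerRight (homComparisonNat hB' q) ULift.upFunctor)
  let e : P.obj (P.objPreimage H) ≅ H := P.objObjPreimageIso H
  let α : Y ⟶ P.objPreimage H := P.preimage (β ≫ e.inv)
  have hα : P.map α ≫ e.hom = β := by simp [α]
  have := (P.objPreimage H).property.1.1
  have hd : (ULift.downFunctor : Z ⥤ (ModuleCat.{v} k)ᵒᵖ).Additive := ⟨rfl⟩
  exact bijective_homComparison_of_extension hB' q
    (F := (P.objPreimage H).obj ⋙ ULift.downFunctor)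
    (Functor.isoWhiskerRight ((isBirex k V W Z).ι.mapIso e) ULift.downFunctor)
    (Functor.whiskerRight α.hom ULift.downFunctor)
    (congrArg (fun f => Functor.whiskerRight ((isBirex k V W Z).ι.map f) ULift.downFunctor) hα) p

end Universal

/-! ### Tensor products of solution spaces of linear equations -/

section LinearAlgebra

variable {k : Type*} [Field k] {I J C D : Type*}
  {L L' N : Type*} [AddCommGroup L] [Module k L] [AddCommGroup L'] [Module k L']
  [AddCommGroup N] [Module k N]
  {M : I → Type*} [∀ i, AddCommGroup (M i)] [∀ i, Module k (M i)]
  {M' : J → Type*} [∀ j, AddCommGroup (M' j)] [∀ j, Module k (M' j)]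
  {P : C → Type*} [∀ c, AddCommGroup (P c)] [∀ c, Module k (P c)]
  {P' : D → Type*} [∀ d, AddCommGroup (P' d)] [∀ d, Module k (P' d)]

lemma equivFinsuppOfBasisRight_rTensor {ι : Type*} [DecidableEq ι] (b : Module.Basis ι k N)
    {M₁ M₂ : Type*} [AddCommGroup M₁] [Module k M₁] [AddCommGroup M₂] [Module k M₂]
    (f : M₁ →ₗ[k] M₂) (x : M₁ ⊗[k] N) (j : ι) :
    TensorProduct.equivFinsuppOfBasisRight b (f.rTensor N x) j =
      f (TensorProduct.equivFinsuppOfBasisRight b x j) := by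
  induction x with
  | zero => simp
  | add x y hx hy => simp [hx, hy]
  | tmul a c => simp

/-- Tensoring with `N` preserves jointly injective families of linear maps. -/
lemma rTensor_jointly_injective {ev : ∀ i, L →ₗ[k] M i}
    (h : ∀ x, (∀ i, ev i x = 0) → x = 0) (x : L ⊗[k] N)
    (hx : ∀ i, (ev i).rTensor N x = 0) : x = 0 := by
  classical
  let b := Module.Free.chooseBasis k N
  refine (TensorProduct.equivFinsuppOfBasisRight b).injective (Finsupp.ext fun j => ?_)
  rw [map_zero, Finsupp.zero_apply]
  refine h _ fun i => ?_
  rw [← equivFinsuppOfBasisRight_rTensor, hx, map_zero, Finsupp.zero_apply]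

lemma lTensor_jointly_injective {ev : ∀ i, L →ₗ[k] M i}
    (h : ∀ x, (∀ i, ev i x = 0) → x = 0) (x : N ⊗[k] L)
    (hx : ∀ i, (ev i).lTensor N x = 0) : x = 0 := by
  refine (TensorProduct.comm k N L).injective ?_
  rw [map_zero]
  refine rTensor_jointly_injective h _ fun i => ?_
  rw [← LinearMap.comm_comp_lTensor_comp_comm_eq]
  simp [hx]

/-- Tensor products of two jointly injective families are jointly injective. -/
lemma map_jointly_injective {ev : ∀ i, L →ₗ[k] M i} {ev' : ∀ j, L' →ₗ[k] M' j}
    (h : ∀ x, (∀ i, ev i x = 0) → x = 0) (h' : ∀ x, (∀ j, ev' j x = 0) → x = 0)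
    (x : L ⊗[k] L') (hx : ∀ i j, TensorProduct.map (ev i) (ev' j) x = 0) : x = 0 := by
  refine lTensor_jointly_injective h' x fun j => rTensor_jointly_injective h _ fun i => ?_
  rw [← LinearMap.comp_apply, LinearMap.rTensor_comp_lTensor, hx]

variable {s t : C → I} {u : ∀ c, M (s c) →ₗ[k] P c} {v : ∀ c, M (t c) →ₗ[k] P c}
  {s' t' : D → J} {u' : ∀ d, M' (s' d) →ₗ[k] P' d} {v' : ∀ d, M' (t' d) →ₗ[k] P' d}
  {ev : ∀ i, L →ₗ[k] M i} {ev' : ∀ j, L' →ₗ[k] M' j}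

/-- If every family `m i : M i` that satisfies the equations `u c (m (s c)) = v c (m (t c))` comes
from `L`, then every family in `M i ⊗ N` that satisfies them comes from `L ⊗ N`, provided that `N`
is finite-dimensional. -/
lemma exists_rTensor_lift [FiniteDimensional k N]
    (hl : ∀ m : ∀ i, M i, (∀ c, u c (m (s c)) = v c (m (t c))) → ∃ x, ∀ i, ev i x = m i)
    (m : ∀ i, M i ⊗[k] N) (hm : ∀ c, (u c).rTensor N (m (s c)) = (v c).rTensor N (m (t c))) :
    ∃ x : L ⊗[k] N, ∀ i, (ev i).rTensor N x = m i := by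
  classical
  let b := Module.finBasis k N
  choose y hy using fun j => hl (fun i => TensorProduct.equivFinsuppOfBasisRight b (m i) j)
    fun c => by
      rw [← equivFinsuppOfBasisRight_rTensor, hm, equivFinsuppOfBasisRight_rTensor]
  refine ⟨(TensorProduct.equivFinsuppOfBasisRight b).symm (Finsupp.equivFunOnFinite.symm y),
    fun i => (TensorProduct.equivFinsuppOfBasisRight b).injective (Finsupp.ext fun j => ?_)⟩
  rw [equivFinsuppOfBasisRight_rTensor, LinearEquiv.apply_symm_apply]
  exact hy j i

lemma exists_lTensor_lift [FiniteDimensional k N]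
    (hl : ∀ m : ∀ i, M i, (∀ c, u c (m (s c)) = v c (m (t c))) → ∃ x, ∀ i, ev i x = m i)
    (m : ∀ i, N ⊗[k] M i) (hm : ∀ c, (u c).lTensor N (m (s c)) = (v c).lTensor N (m (t c))) :
    ∃ x : N ⊗[k] L, ∀ i, (ev i).lTensor N x = m i := by
  obtain ⟨x, hx⟩ := exists_rTensor_lift hl (fun i => TensorProduct.comm k N (M i) (m i))
    fun c => by
      have := congrArg (TensorProduct.comm k N (P c)) (hm c)
      rw [← LinearMap.comm_comp_lTensor_comp_comm_eq, ← LinearMap.comm_comp_lTensor_comp_comm_eq]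
      simpa using this
  refine ⟨(TensorProduct.comm k N L).symm x, fun i => (TensorProduct.comm k N (M i)).injective ?_⟩
  rw [← hx i, ← LinearMap.comm_comp_lTensor_comp_comm_eq]
  rfl

/-- Doubly indexed families in `M i ⊗ M' j` that satisfy both systems of equations come from
`L ⊗ L'`, if `L` and all `M' j` are finite-dimensional. -/
lemma exists_map_lift [FiniteDimensional k L] [∀ j, FiniteDimensional k (M' j)]
    (h : ∀ x, (∀ i, ev i x = 0) → x = 0)
    (hl : ∀ m : ∀ i, M i, (∀ c, u c (m (s c)) = v c (m (t c))) → ∃ x, ∀ i, ev i x = m i)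
    (hl' : ∀ m : ∀ j, M' j, (∀ d, u' d (m (s' d)) = v' d (m (t' d))) → ∃ x, ∀ j, ev' j x = m j)
    (m : ∀ i j, M i ⊗[k] M' j)
    (hm : ∀ c j, (u c).rTensor (M' j) (m (s c) j) = (v c).rTensor (M' j) (m (t c) j))
    (hm' : ∀ i d, (u' d).lTensor (M i) (m i (s' d)) = (v' d).lTensor (M i) (m i (t' d))) :
    ∃ x : L ⊗[k] L', ∀ i j, TensorProduct.map (ev i) (ev' j) x = m i j := by
  choose z hz using fun j => exists_rTensor_lift hl (fun i => m i j) (hm · j)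
  obtain ⟨x, hx⟩ := exists_lTensor_lift hl' z fun d => sub_eq_zero.1 <|
    rTensor_jointly_injective h _ fun i => by
      rw [map_sub, sub_eq_zero, ← LinearMap.comp_apply, ← LinearMap.comp_apply,
        LinearMap.rTensor_comp_lTensor, LinearMap.rTensor_comp_lTensor,
        ← LinearMap.lTensor_comp_rTensor, ← LinearMap.lTensor_comp_rTensor,
        LinearMap.comp_apply, LinearMap.comp_apply, hz, hz, hm']
  refine ⟨x, fun i j => ?_⟩
  rw [← LinearMap.rTensor_comp_lTensor, LinearMap.comp_apply, hx, hz]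

/-- The same with the roles of the two factors exchanged. -/
lemma exists_map_lift' [FiniteDimensional k L'] [∀ i, FiniteDimensional k (M i)]
    (h' : ∀ x, (∀ j, ev' j x = 0) → x = 0)
    (hl : ∀ m : ∀ i, M i, (∀ c, u c (m (s c)) = v c (m (t c))) → ∃ x, ∀ i, ev i x = m i)
    (hl' : ∀ m : ∀ j, M' j, (∀ d, u' d (m (s' d)) = v' d (m (t' d))) → ∃ x, ∀ j, ev' j x = m j)
    (m : ∀ i j, M i ⊗[k] M' j)
    (hm : ∀ c j, (u c).rTensor (M' j) (m (s c) j) = (v c).rTensor (M' j) (m (t c) j))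
    (hm' : ∀ i d, (u' d).lTensor (M i) (m i (s' d)) = (v' d).lTensor (M i) (m i (t' d))) :
    ∃ x : L ⊗[k] L', ∀ i j, TensorProduct.map (ev i) (ev' j) x = m i j := by
  choose z hz using fun i => exists_lTensor_lift hl' (m i) (hm' i)
  obtain ⟨x, hx⟩ := exists_rTensor_lift hl z fun c => sub_eq_zero.1 <|
    lTensor_jointly_injective h' _ fun j => by
      rw [map_sub, sub_eq_zero, ← LinearMap.comp_apply, ← LinearMap.comp_apply,
        LinearMap.lTensor_comp_rTensor, LinearMap.lTensor_comp_rTensor,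
        ← LinearMap.rTensor_comp_lTensor, ← LinearMap.rTensor_comp_lTensor,
        LinearMap.comp_apply, LinearMap.comp_apply, hz, hz, hm]
  refine ⟨x, fun i j => ?_⟩
  rw [← LinearMap.lTensor_comp_rTensor, LinearMap.comp_apply, hx, hz]

end LinearAlgebra

/-! ### Natural transformations between functors of pure tensors -/

section Trace

variable {k : Type u'} [Field k]

variable (k) in
/-- The component at `X` of an element of the categorical trace. -/
def ttrApp {V : Type u₁} [Category.{v} V] [Preadditive V] [Linear k V] (g : V ⥤ V) (X : V) :
    ttr g →ₗ[k] (X ⟶ g.obj X) where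
  toFun φ := φ.app X
  map_add' _ _ := rfl
  map_smul' _ _ := rfl

section

variable {V : Type u₁} [Category.{v} V] [Preadditive V] [Linear k V] (g : V ⥤ V)

lemma eq_zero_of_ttrApp (φ : ttr g) (h : ∀ X, ttrApp k g X φ = 0) : φ = 0 :=
  NatTrans.ext (funext h)

/-- The categorical trace consists of all families of morphisms `X ⟶ g X` that satisfy the linear
equations expressing naturality. -/
lemma exists_ttrApp_eq (m : ∀ X, X ⟶ g.obj X)
    (hm : ∀ c : Σ X X' : V, X ⟶ X', Linear.rightComp k c.1 (g.map c.2.2) (m c.1) =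
      Linear.leftComp k (g.obj c.2.1) c.2.2 (m c.2.1)) :
    ∃ φ : ttr g, ∀ X, ttrApp k g X φ = m X :=
  ⟨{ app := m, naturality := fun X X' f => (hm ⟨X, X', f⟩).symm }, fun _ => rfl⟩

end

variable {V : Type u₁} [Category.{v} V] [Preadditive V] [Linear k V]
  {W : Type u₂} [Category.{v} W] [Preadditive W] [Linear k W]
  {T : Type u₃} [Category.{v} T] [Preadditive T] [Linear k T]
  {B : V × W ⥤ T} (hB : isBil k V W T B)

/-- The map `φ ⊗ ψ ↦ B(φ, ψ)` from `ttr g ⊗ ttr h` to natural transformations `B ⟶ B ∘ (g × h)`. -/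
def ttrTensor (g : V ⥤ V) (h : W ⥤ W) :
    ttr g ⊗[k] ttr h →ₗ[k] (B ⟶ g.prod h ⋙ B) :=
  TensorProduct.lift (LinearMap.mk₂ k
    (fun φ ψ => Functor.whiskerRight (NatTrans.prod φ ψ) B)
    (fun _ _ _ => by ext x; exact hB.map_add_left _ _ _)
    (fun _ _ _ => by ext x; exact hB.map_smul_left _ _ _)
    (fun _ _ _ => by ext x; exact hB.map_add_right _ _ _)
    (fun _ _ _ => by ext x; exact hB.map_smul_right _ _ _))

lemma ttrTensor_app (g : V ⥤ V) (h : W ⥤ W) (x : ttr g ⊗[k] ttr h) (p : V × W) :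
    (ttrTensor hB g h x).app p = homComparison hB p ((g.prod h).obj p)
      (TensorProduct.map (ttrApp k g p.1) (ttrApp k h p.2) x) := by
  induction x with
  | zero => simp
  | add x y hx hy => rw [map_add, map_add, map_add, ← hx, ← hy]; rfl
  | tmul a b => rfl

/-- If `Hom(B(X, Y), B(X', Y')) = Hom(X, X') ⊗ Hom(Y, Y')`, natural transformations
`B ⟶ B ∘ (g × h)` are families in `Hom(X, g X) ⊗ Hom(Y, h Y)` natural in `X` and in `Y`. -/
lemma bijective_ttrTensor (hc : ∀ p q, Function.Bijective (homComparison hB p q))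
    (hV : ∀ X X' : V, FiniteDimensional k (X ⟶ X')) (hW : ∀ Y Y' : W, FiniteDimensional k (Y ⟶ Y'))
    (g : V ⥤ V) (h : W ⥤ W) (hgh : FiniteDimensional k (ttr g) ∨ FiniteDimensional k (ttr h)) :
    Function.Bijective (ttrTensor hB g h) := by
  constructor
  · refine (injective_iff_map_eq_zero _).2 fun x hx => ?_
    refine map_jointly_injective (eq_zero_of_ttrApp g) (eq_zero_of_ttrApp h) x fun X Y =>
      (hc (X, Y) ((g.prod h).obj (X, Y))).1 ?_
    rw [map_zero]
    exact (ttrTensor_app hB g h x (X, Y)).symm.trans (by rw [hx]; rfl)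
  · intro η
    have hsurj (X : V) (Y : W) : ∃ y : (X ⟶ g.obj X) ⊗[k] (Y ⟶ h.obj Y),
        homComparison hB (X, Y) (g.obj X, h.obj Y) y = η.app (X, Y) :=
      (hc (X, Y) (g.obj X, h.obj Y)).2 _
    choose y hy using hsurj
    -- Naturality of `η`, read off in the tensor products of spaces of morphisms.
    have nat {p p' : V × W} (f : p ⟶ p') :
        TensorProduct.map (Linear.rightComp k p.1 (g.map f.1)) (Linear.rightComp k p.2 (h.map f.2))
            (y p.1 p.2) =
          TensorProduct.map (Linear.leftComp k (g.obj p'.1) f.1)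
            (Linear.leftComp k (h.obj p'.2) f.2) (y p'.1 p'.2) := by
      refine (hc p (g.obj p'.1, h.obj p'.2)).1 ?_
      have h₁ := homComparison_postcomp hB ((g.prod h).map f) (y p.1 p.2)
      have h₂ := homComparison_precomp hB (q := (g.obj p'.1, h.obj p'.2)) f (y p'.1 p'.2)
      refine h₁.trans (Eq.trans ?_ h₂.symm)
      refine (congrArg (· ≫ B.map ((g.prod h).map f)) (hy p.1 p.2)).trans
        (Eq.trans ?_ (congrArg (B.map f ≫ ·) (hy p'.1 p'.2)).symm)
      exact (η.naturality f).symm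
    have hm (c : Σ X X' : V, X ⟶ X') (Y : W) :
        (Linear.rightComp k c.1 (g.map c.2.2)).rTensor (Y ⟶ h.obj Y) (y c.1 Y) =
          (Linear.leftComp k (g.obj c.2.1) c.2.2).rTensor (Y ⟶ h.obj Y) (y c.2.1 Y) := by
      have e₁ : Linear.rightComp k Y (h.map (𝟙 Y)) = LinearMap.id := by ext; simp
      have e₂ : Linear.leftComp k (h.obj Y) (𝟙 Y) = LinearMap.id := by ext; simp
      have := nat (p := (c.1, Y)) (p' := (c.2.1, Y)) (Prod.mkHom c.2.2 (𝟙 Y))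
      dsimp only [Prod.mkHom] at this
      rwa [e₁, e₂] at this
    have hm' (X : V) (d : Σ Y Y' : W, Y ⟶ Y') :
        (Linear.rightComp k d.1 (h.map d.2.2)).lTensor (X ⟶ g.obj X) (y X d.1) =
          (Linear.leftComp k (h.obj d.2.1) d.2.2).lTensor (X ⟶ g.obj X) (y X d.2.1) := by
      have e₁ : Linear.rightComp k X (g.map (𝟙 X)) = LinearMap.id := by ext; simp
      have e₂ : Linear.leftComp k (g.obj X) (𝟙 X) = LinearMap.id := by ext; simp
      have := nat (p := (X, d.1)) (p' := (X, d.2.1)) (Prod.mkHom (𝟙 X) d.2.2)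
      dsimp only [Prod.mkHom] at this
      rwa [e₁, e₂] at this
    obtain ⟨x, hx⟩ : ∃ x : ttr g ⊗[k] ttr h, ∀ X Y,
        TensorProduct.map (ttrApp k g X) (ttrApp k h Y) x = y X Y := by
      -- The variable whose trace is finite-dimensional has to be lifted first.
      rcases hgh with _ | _
      · exact exists_map_lift
          (M := fun X => X ⟶ g.obj X) (M' := fun Y => Y ⟶ h.obj Y)
          (ev := ttrApp k g) (ev' := ttrApp k h)
          (P := fun c => c.1 ⟶ g.obj c.2.1) (P' := fun d => d.1 ⟶ h.obj d.2.1)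
          (s := fun c : Σ X X' : V, X ⟶ X' => c.1) (t := fun c => c.2.1)
          (u := fun c => Linear.rightComp k c.1 (g.map c.2.2))
          (v := fun c => Linear.leftComp k (g.obj c.2.1) c.2.2)
          (s' := fun d : Σ Y Y' : W, Y ⟶ Y' => d.1) (t' := fun d => d.2.1)
          (u' := fun d => Linear.rightComp k d.1 (h.map d.2.2))
          (v' := fun d => Linear.leftComp k (h.obj d.2.1) d.2.2)
          (eq_zero_of_ttrApp g) (exists_ttrApp_eq g) (exists_ttrApp_eq h) y
          (fun c j => by convert hm c j using 1) (fun i d => by convert hm' i d using 1)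
      · exact exists_map_lift'
          (M := fun X => X ⟶ g.obj X) (M' := fun Y => Y ⟶ h.obj Y)
          (ev := ttrApp k g) (ev' := ttrApp k h)
          (P := fun c => c.1 ⟶ g.obj c.2.1) (P' := fun d => d.1 ⟶ h.obj d.2.1)
          (s := fun c : Σ X X' : V, X ⟶ X' => c.1) (t := fun c => c.2.1)
          (u := fun c => Linear.rightComp k c.1 (g.map c.2.2))
          (v := fun c => Linear.leftComp k (g.obj c.2.1) c.2.2)
          (s' := fun d : Σ Y Y' : W, Y ⟶ Y' => d.1) (t' := fun d => d.2.1)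
          (u' := fun d => Linear.rightComp k d.1 (h.map d.2.2))
          (v' := fun d => Linear.leftComp k (h.obj d.2.1) d.2.2)
          (eq_zero_of_ttrApp h) (exists_ttrApp_eq g) (exists_ttrApp_eq h) y
          (fun c j => by convert hm c j using 1) (fun i d => by convert hm' i d using 1)
    refine ⟨x, NatTrans.ext (funext fun p => ?_)⟩
    rw [ttrTensor_app, hx]
    exact hy p.1 p.2

end Trace

/-! ### Restriction of traces to pure tensors -/

section Equivalence

variable {C : Type u} [Category.{v} C] {D : Type u'} [Category.{v'} D] (E : C ≌ D)

lemma bijective_map_comp_counit (c : C) (d : D) :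
    Function.Bijective fun f : c ⟶ E.inverse.obj d => E.functor.map f ≫ E.counit.app d := by
  have h : (fun f : c ⟶ E.inverse.obj d => E.functor.map f ≫ E.counit.app d) =
      (E.toAdjunction.homEquiv c d).symm :=
    funext fun f => (E.toAdjunction.homEquiv_counit (g := f)).symm
  exact h ▸ Equiv.bijective _

lemma map_comp_counit_naturality {c : C} {d d' : D} (f : c ⟶ E.inverse.obj d) (m : d ⟶ d') :
    E.functor.map (f ≫ E.inverse.map m) ≫ E.counit.app d' =
      (E.functor.map f ≫ E.counit.app d) ≫ m := by
  simp

lemma map_comp_counit_unit_mapIso {c : C} {d d' : D} (j : d ≅ E.functor.obj c) (m : d ⟶ d') :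
    E.functor.map ((E.inverse.mapIso j ≪≫ (E.unitIso.app c).symm).inv ≫ E.inverse.map m) ≫
      E.counit.app d' = j.inv ≫ m := by
  simp

end Equivalence

section Linear

variable {k : Type u'} [Field k]
  {V : Type u₁} [Category.{v} V] [Preadditive V] [Linear k V]
  {W : Type u₂} [Category.{v} W] [Preadditive W] [Linear k W]
  {T : Type u₃} [Category.{v} T] [Preadditive T] [Linear k T]

namespace IsLinearTensor

variable [HasFiniteBiproducts T] {B : V × W ⥤ T} (hB : IsLinearTensor k V W T B)

/-- Restricting an element of the trace of `g ⊠ h` to pure tensors gives a natural transformation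
`B ⟶ B ∘ (g × h)`. -/
def restrictTrace (p : LinFun k V V × LinFun k W W) :
    ttr (hB.box.obj p).obj →ₗ[k] (B ⟶ p.1.obj.prod p.2.obj ⋙ B) where
  toFun φ := Functor.whiskerLeft B φ ≫ (hB.selfEquiv.counit.app ((extProd hB.bilinear).obj p)).hom
  map_add' φ φ' := by
    ext x
    exact Preadditive.add_comp _ _ _ _ _ _
  map_smul' c φ := by
    ext x
    exact Linear.smul_comp _ _ _ _ _ _

/-- The universal property makes a natural transformation out of the identity determined by its
restriction to pure tensors, which may be arbitrary. -/
lemma bijective_restrictTrace (p : LinFun k V V × LinFun k W W) :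
    Function.Bijective (hB.restrictTrace p) := by
  refine (((isBil k V W T).fullyFaithfulι.map_bijective _ _).comp
    (bijective_map_comp_counit hB.selfEquiv (idLin k T) ((extProd hB.bilinear).obj p))).comp
    (f := fun φ => (ObjectProperty.homMk φ : idLin k T ⟶ hB.box.obj p)) ?_
  exact ((isLin k T T).fullyFaithfulι.homEquiv (X := idLin k T)
    (Y := hB.box.obj p)).symm.bijective

lemma restrictTrace_naturality {p p' : LinFun k V V × LinFun k W W} (f : p ⟶ p')
    (φ : ttr (hB.box.obj p).obj) :
    hB.restrictTrace p' (φ ≫ (hB.box.map f).hom) =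
      hB.restrictTrace p φ ≫ ((extProd hB.bilinear).map f).hom :=
  congrArg InducedCategory.Hom.hom (map_comp_counit_naturality hB.selfEquiv
    (ObjectProperty.homMk φ : idLin k T ⟶ hB.box.obj p) ((extProd hB.bilinear).map f))

/-- On pure tensors, `μ (φ ⊗ ψ)` is `B(φ, ψ)`. -/
lemma restrictTrace_comp_mu (g : LinFun k V V) (h : LinFun k W W) :
    hB.restrictTrace (g, h) ∘ₗ hB.mu g h = ttrTensor hB.bilinear g.obj h.obj := by
  refine TensorProduct.ext' fun φ ψ => ?_
  have e : hB.selfEquiv.functor.map (hB.kappaOne.inv ≫ hB.boxMap φ ψ) ≫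
      hB.selfEquiv.counit.app ((extProd hB.bilinear).obj (g, h)) =
      (extProd hB.bilinear).map (Prod.mkHom (ObjectProperty.homMk φ : idLin k V ⟶ g)
        (ObjectProperty.homMk ψ : idLin k W ⟶ h)) :=
    (map_comp_counit_unit_mapIso hB.selfEquiv _ _).trans (Category.id_comp _)
  exact congrArg InducedCategory.Hom.hom e

end IsLinearTensor

end Linear

section Abelian

variable {k : Type u'} [Field k]
  {A : Type u₁} [Category.{v} A] [Abelian A] [Linear k A]
  {B : Type u₂} [Category.{v} B] [Abelian B] [Linear k B]
  {T : Type u₃} [Category.{v} T] [Abelian T] [Linear k T]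

lemma isBirex.isBil {M : A × B ⥤ T} (hM : isBirex k A B T M) : isBil k A B T M :=
  ⟨fun X => (hM.1 X).1, fun Y => (hM.2 Y).1⟩

variable (k) in
/-- The identity functor as a right exact linear functor. -/
abbrev idRex (C : Type u) [Category.{v} C] [Preadditive C] [Linear k C] : RexFun k C C :=
  ⟨𝟭 C, isLin_id k, inferInstance⟩

namespace IsDeligneTensor

variable {M : A × B ⥤ T} (hM : IsDeligneTensor k A B T M)

/-- Restricting an element of the trace of the Deligne tensor product of `g` and `h` to pure
tensors gives a natural transformation `M ⟶ M ∘ (g × h)`. -/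
def restrictTrace (p : RexFun k A A × RexFun k B B) :
    ttr (hM.box.obj p).obj →ₗ[k] (M ⟶ p.1.obj.prod p.2.obj ⋙ M) where
  toFun φ := Functor.whiskerLeft M φ ≫ (hM.selfEquiv.counit.app ((extProdRex hM.birex).obj p)).hom
  map_add' φ φ' := by
    ext x
    exact Preadditive.add_comp _ _ _ _ _ _
  map_smul' c φ := by
    ext x
    exact Linear.smul_comp _ _ _ _ _ _

lemma bijective_restrictTrace (p : RexFun k A A × RexFun k B B) :
    Function.Bijective (hM.restrictTrace p) := by
  refine (((isBirex k A B T).fullyFaithfulι.map_bijective _ _).comp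
    (bijective_map_comp_counit hM.selfEquiv (idRex k T) ((extProdRex hM.birex).obj p))).comp
    (f := fun φ => (ObjectProperty.homMk φ : idRex k T ⟶ hM.box.obj p)) ?_
  exact ((isRex k T T).fullyFaithfulι.homEquiv (X := idRex k T)
    (Y := hM.box.obj p)).symm.bijective

lemma restrictTrace_naturality {p p' : RexFun k A A × RexFun k B B} (f : p ⟶ p')
    (φ : ttr (hM.box.obj p).obj) :
    hM.restrictTrace p' (φ ≫ (hM.box.map f).hom) =
      hM.restrictTrace p φ ≫ ((extProdRex hM.birex).map f).hom :=
  congrArg InducedCategory.Hom.hom (map_comp_counit_naturality hM.selfEquiv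
    (ObjectProperty.homMk φ : idRex k T ⟶ hM.box.obj p) ((extProdRex hM.birex).map f))

end IsDeligneTensor

end Abelian

/-! ### Comparison of two tensor products -/

section Transfer

variable {k : Type u'} [Field k]
  {V : Type u₁} [Category.{v} V] [Preadditive V] [Linear k V]
  {W : Type u₂} [Category.{v} W] [Preadditive W] [Linear k W]
  {T : Type u₃} [Category.{v} T] [Preadditive T] [Linear k T]
  {T' : Type u₃} [Category.{v} T'] [Preadditive T'] [Linear k T']
  {B : V × W ⥤ T} (hB : isBil k V W T B) {B' : V × W ⥤ T'} (hB' : isBil k V W T' B')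
  (hc : ∀ p q, Function.Bijective (homComparison hB p q))
  (hc' : ∀ p q, Function.Bijective (homComparison hB' p q))

/-- If the morphisms between the values of two bilinear functors `B` and `B'` are both given by the
tensor products of the spaces of morphisms, they are identified with each other. -/
def homTransfer (p q : V × W) : (B.obj p ⟶ B.obj q) ≃ₗ[k] (B'.obj p ⟶ B'.obj q) :=
  (LinearEquiv.ofBijective _ (hc p q)).symm ≪≫ₗ LinearEquiv.ofBijective _ (hc' p q)

lemma homTransfer_homComparison {p q : V × W} (x : (p.1 ⟶ q.1) ⊗[k] (p.2 ⟶ q.2)) :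
    homTransfer hB hB' hc hc' p q (homComparison hB p q x) = homComparison hB' p q x :=
  congrArg (homComparison hB' p q) ((LinearEquiv.ofBijective _ (hc p q)).symm_apply_apply x)

lemma homTransfer_precomp {p p' q : V × W} (f : p ⟶ p') (t : B.obj p' ⟶ B.obj q) :
    homTransfer hB hB' hc hc' p q (B.map f ≫ t) =
      B'.map f ≫ homTransfer hB hB' hc hc' p' q t := by
  obtain ⟨x, rfl⟩ := (hc p' q).2 t
  rw [← homComparison_precomp, homTransfer_homComparison, homTransfer_homComparison,
    homComparison_precomp]

lemma homTransfer_postcomp {p q q' : V × W} (f : q ⟶ q') (t : B.obj p ⟶ B.obj q) :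
    homTransfer hB hB' hc hc' p q' (t ≫ B.map f) =
      homTransfer hB hB' hc hc' p q t ≫ B'.map f := by
  obtain ⟨x, rfl⟩ := (hc p q).2 t
  rw [← homComparison_postcomp, homTransfer_homComparison, homTransfer_homComparison,
    homComparison_postcomp]

/-- The identification of natural transformations `B ⟶ B ∘ G` and `B' ⟶ B' ∘ G` given by
`homTransfer` on components. -/
def natTransfer (G : V × W ⥤ V × W) : (B ⟶ G ⋙ B) ≃ₗ[k] (B' ⟶ G ⋙ B') where
  toFun η :=
    { app := fun p => homTransfer hB hB' hc hc' p (G.obj p) (η.app p)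
      naturality := fun p p' f => by
        refine (homTransfer_precomp hB hB' hc hc' f _).symm.trans ?_
        rw [η.naturality f]
        exact homTransfer_postcomp hB hB' hc hc' (G.map f) _ }
  invFun η :=
    { app := fun p => homTransfer hB' hB hc' hc p (G.obj p) (η.app p)
      naturality := fun p p' f => by
        refine (homTransfer_precomp hB' hB hc' hc f _).symm.trans ?_
        rw [η.naturality f]
        exact homTransfer_postcomp hB' hB hc' hc (G.map f) _ }
  map_add' η η' := NatTrans.ext (funext fun _ => map_add _ _ _)
  map_smul' c η := NatTrans.ext (funext fun _ => map_smul _ _ _)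
  left_inv η := NatTrans.ext (funext fun p => (homTransfer hB hB' hc hc' p _).left_inv _)
  right_inv η := NatTrans.ext (funext fun p => (homTransfer hB hB' hc hc' p _).right_inv _)

lemma natTransfer_comp_whiskerRight {G G' : V × W ⥤ V × W} (η : B ⟶ G ⋙ B) (θ : G ⟶ G') :
    natTransfer hB hB' hc hc' G' (η ≫ Functor.whiskerRight θ B) =
      natTransfer hB hB' hc hc' G η ≫ Functor.whiskerRight θ B' :=
  NatTrans.ext (funext fun p => homTransfer_postcomp hB hB' hc hc' (θ.app p) (η.app p))

end Transfer

section TraceIso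

variable {k : Type v} [Field k]
  {A : Type u₁} [Category.{v} A] [Abelian A] [Linear k A]
  {B : Type u₂} [Category.{v} B] [Abelian B] [Linear k B]
  {T : Type (max w (v + 1))} [Category.{v} T] [Preadditive T] [HasFiniteBiproducts T] [Linear k T]
  {F : A × B ⥤ T} (hF : IsLinearTensor k A B T F)
  {D : Type (max w (v + 1))} [Category.{v} D] [Abelian D] [Linear k D]
  {M : A × B ⥤ D} (hM : IsDeligneTensor k A B D M)

/-- `natTransfer` from the tensor product of linear categories to the Deligne tensor product. -/
def tensorTransfer (G : A × B ⥤ A × B) : (F ⟶ G ⋙ F) ≃ₗ[k] (M ⟶ G ⋙ M) :=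
  natTransfer hF.bilinear hM.birex.isBil hF.bijective_homComparison
    (hM.bijective_homComparison hM.birex.isBil) G

/-- The traces of the two tensor products of `g` and `h` are identified with the natural
transformations `F ⟶ F ∘ (g × h)`, respectively `M ⟶ M ∘ (g × h)`, and these with each other because
`F` and `M` have the same morphisms between pure tensors. -/
def traceEquiv (p : RexFun k A A × RexFun k B B) :
    ttr (hF.box.obj (((rexToLin k A A).prod (rexToLin k B B)).obj p)).obj ≃ₗ[k]
      ttr (hM.box.obj p).obj :=
  LinearEquiv.ofBijective _
      (hF.bijective_restrictTrace (((rexToLin k A A).prod (rexToLin k B B)).obj p)) ≪≫ₗ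
    tensorTransfer hF hM (p.1.obj.prod p.2.obj) ≪≫ₗ
    (LinearEquiv.ofBijective _ (hM.bijective_restrictTrace p)).symm

lemma restrictTrace_traceEquiv (p : RexFun k A A × RexFun k B B)
    (φ : ttr (hF.box.obj (((rexToLin k A A).prod (rexToLin k B B)).obj p)).obj) :
    hM.restrictTrace p (traceEquiv hF hM p φ) =
      tensorTransfer hF hM (p.1.obj.prod p.2.obj) (hF.restrictTrace _ φ) :=
  (LinearEquiv.ofBijective _ (hM.bijective_restrictTrace p)).apply_symm_apply _

lemma traceEquiv_naturality {p p' : RexFun k A A × RexFun k B B} (f : p ⟶ p')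
    (φ : ttr (hF.box.obj (((rexToLin k A A).prod (rexToLin k B B)).obj p)).obj) :
    traceEquiv hF hM p'
        (φ ≫ (hF.box.map (((rexToLin k A A).prod (rexToLin k B B)).map f)).hom) =
      traceEquiv hF hM p φ ≫ (hM.box.map f).hom := by
  refine (hM.bijective_restrictTrace p').1 ?_
  rw [restrictTrace_traceEquiv, hM.restrictTrace_naturality, restrictTrace_traceEquiv,
    hF.restrictTrace_naturality]
  exact natTransfer_comp_whiskerRight _ _ _ _ _ (NatTrans.prod f.1.hom f.2.hom)

/-- The isomorphism between the traces of the two tensor products, natural in `(g, h)`. -/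
def traceIso :
    (rexToLin k A A).prod (rexToLin k B B) ⋙ hF.box ⋙ (isLin k T T).ι ⋙ ttrFunctor k T ≅
      hM.box ⋙ (isRex k D D).ι ⋙ ttrFunctor k D :=
  NatIso.ofComponents (fun p => (traceEquiv hF hM p).toModuleIso)
    (fun f => ModuleCat.hom_ext (LinearMap.ext fun φ => traceEquiv_naturality hF hM f φ))

end TraceIso

end CatTrace

end

theorem theorem2 {k : Type v} [Field k] [IsAlgClosed k] :
    (∀ (V : Type u₁) [Category.{v} V] [Preadditive V] [HasFiniteBiproducts V] [Linear k V]
        (W : Type u₂) [Category.{v} W] [Preadditive W] [HasFiniteBiproducts W] [Linear k W]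
        (T : Type (max u₁ u₂ (v + 1))) [Category.{v} T] [Preadditive T] [HasFiniteBiproducts T]
        [Linear k T] (box : V × W ⥤ T) (hbox : CatTrace.IsLinearTensor k V W T box),
      (∀ X X' : V, FiniteDimensional k (X ⟶ X')) →
      (∀ Y Y' : W, FiniteDimensional k (Y ⟶ Y')) →
      ∀ (g : CatTrace.LinFun k V V) (h : CatTrace.LinFun k W W),
        FiniteDimensional k (CatTrace.ttr g.obj) ∨ FiniteDimensional k (CatTrace.ttr h.obj) →
        Function.Bijective (hbox.mu g h)) ∧
    (∀ (A : Type u₁) [Category.{v} A] [Abelian A] [Linear k A]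
        (B : Type u₂) [Category.{v} B] [Abelian B] [Linear k B]
        (T : Type (max u₁ u₂ (v + 1))) [Category.{v} T] [Preadditive T] [HasFiniteBiproducts T]
        [Linear k T] (box : A × B ⥤ T) (hbox : CatTrace.IsLinearTensor k A B T box)
        (D : Type (max u₁ u₂ (v + 1))) [Category.{v} D] [Abelian D] [Linear k D]
        (dbox : A × B ⥤ D) (hdbox : CatTrace.IsDeligneTensor k A B D dbox),
      CatTrace.DeligneFinite k A → CatTrace.DeligneFinite k B →
      Nonempty
        ((CatTrace.finiteTracePairs k A B).ι ⋙ (CatTrace.rexToLin k A A).prod (CatTrace.rexToLin k B B) ⋙ hbox.box ⋙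
            (CatTrace.isLin k T T).ι ⋙ CatTrace.ttrFunctor k T ≅
          (CatTrace.finiteTracePairs k A B).ι ⋙ hdbox.box ⋙ (CatTrace.isRex k D D).ι ⋙ CatTrace.ttrFunctor k D)) := by
  constructor
  · intro V _ _ _ _ W _ _ _ _ T _ _ _ _ box hbox hV hW g h hgh
    have hb := CatTrace.bijective_ttrTensor hbox.bilinear
      (CatTrace.IsLinearTensor.bijective_homComparison.{max u₁ u₂} hbox) hV hW g.obj h.obj hgh
    rw [← hbox.restrictTrace_comp_mu] at hb
    exact (Function.Bijective.of_comp_iff' (hbox.bijective_restrictTrace (g, h)) _).1 hb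
  · intro A _ _ _ B _ _ _ T _ _ _ _ box hbox D _ _ _ dbox hdbox _ _
    exact ⟨Functor.isoWhiskerLeft (CatTrace.finiteTracePairs k A B).ι
      (CatTrace.traceIso.{max u₁ u₂} hbox hdbox)⟩
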